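/- Let $G$ be a finite group. A subset $\{g_1,\dots,g_d\}$ of $G$ *invariably generates* $G$ if $\{g_1^{x_1},\dots,g_d^{x_d}\}$ generates $G$ for every choice of $x_1,\dots,x_d\in G$, where $g^x=x^{-1}gx$. The group $G$ is *CIG* (coprimely-invariably generated) if it has an invariably generating subset whose distinct elements have pairwise coprime orders, and *PCIG* if such a subset can be chosen so that, moreover, all its elements have prime-power order (the order $1=p^0$ is allowed). **Theorem.** Let $G$ be a finite soluble group. (1) Suppose that $\{g_1,\dots,g_d\}$ invariably generates $G$ and that the orders $|g_1|,\dots,|g_d|$ are pairwise coprime. For each $i\in\{1,\dots,d\}$ write $g_i=x_{i,1}\cdots x_{i,u_i}$, where the $x_{i,j}$ are powers of $g_i$ whose orders are prime powers and, for fixed $i$, pairwise coprime. Then the set $X=\{x_{i,j}\mid 1\le i\le d,\ 1\le j\le u_i\}$ invariably generates $G$. (2) Consequently, $G$ is CIG if and only if it is PCIG. -/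

import Mathlib

/-- A subset `S` of a group `G` invariably generates `G` if, for every choice of a conjugating
element `c s` for each `s ∈ S`, the conjugates `s ^ (c s) = (c s)⁻¹ * s * c s` generate `G`. -/
def InvariablyGenerates {G : Type*} [Group G] (S : Set G) : Prop :=
  ∀ c : G → G, Subgroup.closure ((fun s => (c s)⁻¹ * s * c s) '' S) = ⊤

/-- The order of `x` is a prime power `p ^ k`, where `p ^ 0 = 1` is allowed. -/
def HasPrimePowerOrder {G : Type*} [Group G] (x : G) : Prop :=
  ∃ p k : ℕ, p.Prime ∧ orderOf x = p ^ k

/-- `S` invariably generates `G` and its (distinct) elements have pairwise coprime orders. -/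
def IsCIGSet {G : Type*} [Group G] (S : Set G) : Prop :=
  InvariablyGenerates S ∧ S.Pairwise (fun a b => (orderOf a).Coprime (orderOf b))

/-- A CIG-set all of whose elements have prime-power order. -/
def IsPCIGSet {G : Type*} [Group G] (S : Set G) : Prop :=
  IsCIGSet S ∧ ∀ s ∈ S, HasPrimePowerOrder s

/-- `G` is coprimely-invariably generated. -/
def IsCIG (G : Type*) [Group G] : Prop :=
  ∃ S : Set G, S.Finite ∧ IsCIGSet S

/-- `G` is prime-power coprimely-invariably generated. -/
def IsPCIG (G : Type*) [Group G] : Prop :=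
  ∃ S : Set G, S.Finite ∧ IsPCIGSet S

/-! If some conjugates of the factors fail to generate, they lie in a maximal subgroup `M`. Modulo
the core of `M`, solubility gives a normal abelian subgroup `A` of prime exponent `p`, complemented
by `M`. Split each `g` as `a * b`, with `a` a single factor (or 1) and `b` a commuting `p'`-element.
As `a` is conjugate into `M`, it suffices to absorb `b`: an averaging argument conjugates `b` into
`M` by an element of `A` centralising `a` (`exists_conj_mul_mem_of_complement`). So every `g` is
conjugate into `M`, against invariable generation. -/

section ComplementedAbelian

variable {G : Type*} [Group G]

/-- In a group with a normal abelian subgroup `A` of prime exponent `p` complemented by `M`, if `b`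
commutes with `a ∈ M` and has order prime to `p`, then `a * b` is conjugate into `M`. -/
theorem exists_conj_mul_mem_of_complement {A M : Subgroup G} [A.Normal]
    (hcomm : ∀ x ∈ A, ∀ y ∈ A, x * y = y * x) {p : ℕ} (hexp : ∀ x ∈ A, x ^ p = 1)
    (hsup : A ⊔ M = ⊤) (hinf : A ⊓ M = ⊥) {a b : G} (ha : a ∈ M) (hab : Commute a b)
    (hb : (orderOf b).Coprime p) : ∃ y : G, y⁻¹ * (a * b) * y ∈ M := by
  have hdisj : ∀ x ∈ A, x ∈ M → x = 1 := fun x h1 h2 =>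
    Subgroup.mem_bot.1 (hinf ▸ Subgroup.mem_inf.2 ⟨h1, h2⟩)
  obtain ⟨n, hn, h, hh, rfl⟩ : ∃ n ∈ A, ∃ h ∈ M, n * h = b :=
    Subgroup.mem_sup_of_normal_left.1 (hsup ▸ Subgroup.mem_top b)
  -- `a` centralises both components of `n * h`
  have hnA : a * n * a⁻¹ ∈ A := ‹A.Normal›.conj_mem n hn a
  -- Conjugation by `a` fixes `n * h`; the left side lies in `A`, the right side in `M`.
  have hsplit : n⁻¹ * (a * n * a⁻¹) = h * (a * h * a⁻¹)⁻¹ := by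
    have : a * n * a⁻¹ * (a * h * a⁻¹) = n * h := by
      have := hab.eq
      calc a * n * a⁻¹ * (a * h * a⁻¹) = a * (n * h) * a⁻¹ := by group
        _ = n * h := by rw [this]; group
    rw [inv_mul_eq_iff_eq_mul, ← mul_assoc, ← this]; group
  have hone : n⁻¹ * (a * n * a⁻¹) = 1 :=
    hdisj _ (mul_mem (inv_mem hn) hnA)
      (hsplit ▸ mul_mem hh (inv_mem (mul_mem (mul_mem ha hh) (inv_mem ha))))
  have han : Commute a n := by
    have : a * n * a⁻¹ = n := (inv_mul_eq_one.1 hone).symm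
    exact mul_inv_eq_iff_eq_mul.1 this
  have hah : Commute a h := by
    have := han.inv_right.mul_right hab
    simpa using this
  set b := n * h with hbdef
  set k := orderOf b with hk
  -- The 1-cocycle comparing `b` with `h`; it is a coboundary because `k` is prime to `p`.
  let c : ℕ → G := fun i => b ^ i * (h ^ i)⁻¹
  have hc_succ : ∀ i, c (i + 1) = n * (h * c i * h⁻¹) := fun i => by
    calc c (i + 1) = b * b ^ i * (h * h ^ i)⁻¹ := by simp only [c, pow_succ']
      _ = b * c i * h⁻¹ := by simp only [c, mul_inv_rev, mul_assoc]
      _ = n * (h * c i * h⁻¹) := by rw [hbdef]; simp only [mul_assoc]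
  have hcA : ∀ i, c i ∈ A := fun i => by
    induction i with
    | zero => simp [c]
    | succ i ih => rw [hc_succ]; exact mul_mem hn (‹A.Normal›.conj_mem _ ih h)
  have hc0 : c 0 = 1 := by simp [c]
  have hck : c k = 1 := by
    refine hdisj _ (hcA k) ?_
    simp only [c, hk, pow_orderOf_eq_one, one_mul]
    exact inv_mem (pow_mem hh _)
  have hca : ∀ i, Commute a (c i) := fun i =>
    (hab.pow_right i).mul_right (hah.pow_right i).inv_right
  -- the partial products of `c`
  let P : ℕ → G := fun m => ((List.range m).map c).prod
  have hP_succ : ∀ m, P (m + 1) = P m * c m := fun m => by simp [P, List.range_succ]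
  have hPA : ∀ m, P m ∈ A := fun m => by
    induction m with
    | zero => simp [P]
    | succ m ih => rw [hP_succ]; exact mul_mem ih (hcA m)
  have hPa : ∀ m, Commute a (P m) := fun m => by
    induction m with
    | zero => simp [P]
    | succ m ih => rw [hP_succ]; exact ih.mul_right (hca m)
  -- The recursion for `c`, multiplied over `i < m`. At `m = k` the factor `c k` is trivial; raising
  -- to the power `l`, an inverse of `k` modulo the order of `n`, turns `n ^ k` into `n`.
  have hP : ∀ m, P m * c m = n ^ m * (h * P m * h⁻¹) := fun m => by
    induction m with
    | zero => simp [P, hc0]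
    | succ m ih =>
      have h1 : h * P m * h⁻¹ ∈ A := ‹A.Normal›.conj_mem _ (hPA m) h
      rw [hP_succ, ih, hc_succ, pow_succ]
      calc n ^ m * (h * P m * h⁻¹) * (n * (h * c m * h⁻¹))
          = n ^ m * ((h * P m * h⁻¹) * n) * (h * c m * h⁻¹) := by group
        _ = n ^ m * (n * (h * P m * h⁻¹)) * (h * c m * h⁻¹) := by rw [hcomm _ h1 _ hn]
        _ = n ^ m * n * (h * (n ^ m * (h * P m * h⁻¹)) * h⁻¹) := by rw [← ih]; group
  obtain ⟨l, hl⟩ : ∃ l : ℕ, n ^ (k * l) = n := by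
    have : (orderOf n).Coprime k :=
      (Nat.Coprime.coprime_dvd_right (orderOf_dvd_of_pow_eq_one (hexp n hn)) hb).symm
    obtain ⟨l, hl⟩ := exists_pow_eq_self_of_coprime this.symm
    exact ⟨l, by rw [pow_mul, hl]⟩
  have hy : P k ^ l = n * (h * P k ^ l * h⁻¹) := by
    have h1 : P k = n ^ k * (h * P k * h⁻¹) := by rw [← hP, hck, mul_one]
    have h2 : Commute (n ^ k) (h * P k * h⁻¹) :=
      hcomm _ (pow_mem hn k) _ (‹A.Normal›.conj_mem _ (hPA k) h)
    calc P k ^ l = (n ^ k * (h * P k * h⁻¹)) ^ l := by rw [← h1]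
      _ = n * (h * P k ^ l * h⁻¹) := by rw [h2.mul_pow, ← pow_mul, hl, conj_pow]
  refine ⟨P k ^ l, ?_⟩
  have hya : Commute a (P k ^ l) := (hPa k).pow_right l
  have h3 : b * P k ^ l = P k ^ l * h := by
    conv_rhs => rw [hy]
    rw [hbdef]; group
  have : (P k ^ l)⁻¹ * (a * b) * P k ^ l = a * h := by
    rw [mul_assoc, mul_assoc, h3, inv_mul_eq_iff_eq_mul, ← mul_assoc, hya.eq, mul_assoc]
  exact this ▸ mul_mem ha hh

end ComplementedAbelian

/-! ### Maximal subgroups of soluble groups -/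

section Solvable

open scoped commutatorElement

/-- A nontrivial finite solvable group has a nontrivial normal abelian subgroup of prime
exponent. -/
theorem exists_normal_elementary_abelian (Q : Type*) [Group Q] [Finite Q] [Group.IsSolvable Q]
    [Nontrivial Q] : ∃ (p : ℕ) (A : Subgroup Q), p.Prime ∧ A.Normal ∧ A ≠ ⊥ ∧
      (∀ x ∈ A, ∀ y ∈ A, x * y = y * x) ∧ ∀ x ∈ A, x ^ p = 1 := by
  classical
  -- `B` is the last nontrivial term of the derived series.
  obtain ⟨B, hBn, hB, hBc⟩ : ∃ B : Subgroup Q, B.Normal ∧ B ≠ ⊥ ∧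
      ∀ x ∈ B, ∀ y ∈ B, x * y = y * x := by
    have hex : ∃ n, derivedSeries Q n = ⊥ := Group.IsSolvable.solvable
    have hpos : Nat.find hex ≠ 0 := fun h0 => by
      have := Nat.find_spec hex
      rw [h0, derivedSeries_zero] at this
      exact top_ne_bot this
    obtain ⟨m, hm⟩ := Nat.exists_eq_succ_of_ne_zero hpos
    refine ⟨derivedSeries Q m, inferInstance, Nat.find_min hex (by omega), fun x hx y hy => ?_⟩
    have h1 : ⁅x, y⁆ ∈ derivedSeries Q (m + 1) := by
      rw [derivedSeries_succ]; exact Subgroup.commutator_mem_commutator hx hy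
    have h2 := Nat.find_spec hex
    rw [hm] at h2
    rw [h2, Subgroup.mem_bot] at h1
    exact commutatorElement_eq_one_iff_mul_comm.1 h1
  have hcard : Nat.card B ≠ 1 := fun h => hB (Subgroup.card_eq_one.1 h)
  obtain ⟨p, hp, hpd⟩ := Nat.exists_prime_and_dvd hcard
  have := Fact.mk hp
  obtain ⟨z, hz⟩ := exists_prime_orderOf_dvd_card' p hpd
  refine ⟨p, ⟨⟨⟨{x | x ∈ B ∧ x ^ p = 1}, ?_⟩, ?_⟩, ?_⟩, hp, ⟨?_⟩, ?_, ?_, ?_⟩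
  · rintro x y ⟨hx, hx1⟩ ⟨hy, hy1⟩
    refine ⟨mul_mem hx hy, ?_⟩
    rw [(show Commute x y from hBc x hx y hy).mul_pow, hx1, hy1, one_mul]
  · exact ⟨one_mem _, one_pow _⟩
  · rintro x ⟨hx, hx1⟩
    exact ⟨inv_mem hx, by rw [inv_pow, hx1, inv_one]⟩
  · rintro x ⟨hx, hx1⟩ g
    exact ⟨hBn.conj_mem x hx g, by rw [conj_pow, hx1]; simp⟩
  · intro h
    have hmem : (z : Q) ∈ (⊥ : Subgroup Q) := by
      rw [← h]
      refine ⟨z.2, ?_⟩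
      have := pow_orderOf_eq_one z
      rw [hz] at this
      exact_mod_cast congrArg Subtype.val this
    have hz1 : z = 1 := Subtype.ext (Subgroup.mem_bot.1 hmem)
    rw [hz1, orderOf_one] at hz
    exact hp.one_lt.ne hz
  · exact fun x hx y hy => hBc x hx.1 y hy.1
  · exact fun x hx => hx.2

variable {G : Type*} [Group G]

/-- For a maximal subgroup `M` of a finite solvable group there is a prime `p` such that
multiplying an element conjugate into `M` by a commuting `p'`-element gives an element
conjugate into `M`. -/
theorem exists_prime_forall_conj_mul_mem_of_isCoatom [Finite G] [Group.IsSolvable G]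
    {M : Subgroup G} (hM : IsCoatom M) : ∃ p : ℕ, p.Prime ∧ ∀ a b : G, Commute a b →
      (orderOf b).Coprime p → (∃ x : G, x⁻¹ * a * x ∈ M) → ∃ y : G, y⁻¹ * (a * b) * y ∈ M := by
  let K := M.normalCore
  let π := QuotientGroup.mk' K
  have hπ : Function.Surjective π := QuotientGroup.mk'_surjective K
  have hKM : K ≤ M := M.normalCore_le
  have hmem : ∀ x, π x ∈ M.map π ↔ x ∈ M := fun x => by
    rw [← Subgroup.mem_comap, Subgroup.comap_map_eq, QuotientGroup.ker_mk', sup_eq_left.2 hKM]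
  have : Nontrivial (G ⧸ K) := by
    rw [QuotientGroup.nontrivial_iff]
    exact fun h => hM.1 (top_le_iff.1 (h ▸ hKM))
  have : Group.IsSolvable (G ⧸ K) := inferInstance
  obtain ⟨p, A, hp, hAn, hA, hAc, hAp⟩ := exists_normal_elementary_abelian (G ⧸ K)
  refine ⟨p, hp, ?_⟩
  -- a subgroup of `M.map π` that is normal in the quotient is trivial
  have hcore : ∀ B : Subgroup (G ⧸ K), B.Normal → B ≤ M.map π → B = ⊥ := fun B hB hBM => by
    have := hB.comap π
    have h1 : B.comap π ≤ M := fun x hx => (hmem x).1 (hBM hx)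
    have h2 : B.comap π ≤ K := Subgroup.normal_le_normalCore.2 h1
    rw [eq_bot_iff]
    intro y hy
    obtain ⟨x, rfl⟩ := hπ y
    exact (QuotientGroup.eq_one_iff x).2 (h2 hy)
  have hsup : A ⊔ M.map π = ⊤ := by
    have hlt : M < (A ⊔ M.map π).comap π := by
      refine lt_of_le_of_ne (fun x hx => ?_) fun h => ?_
      · exact (le_sup_right : M.map π ≤ _) ((hmem x).2 hx)
      · refine hA (hcore A hAn fun y hy => ?_)
        obtain ⟨x, rfl⟩ := hπ y
        refine (hmem x).2 ?_
        rw [h]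
        exact (le_sup_left : A ≤ _) hy
    have htop := hM.2 _ hlt
    rw [eq_top_iff]
    intro y _
    obtain ⟨x, rfl⟩ := hπ y
    have : x ∈ (A ⊔ M.map π).comap π := htop ▸ Subgroup.mem_top x
    exact this
  -- The intersection is normalised by `M.map π` and centralised by the abelian `A`, hence normal.
  have hinf : A ⊓ M.map π = ⊥ := by
    refine hcore _ ⟨?_⟩ inf_le_right
    intro x hx g
    obtain ⟨hxA, hxM⟩ := Subgroup.mem_inf.1 hx
    obtain ⟨n, hn, h, hh, rfl⟩ := Subgroup.mem_sup_of_normal_left.1 (hsup ▸ Subgroup.mem_top g)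
    have h1 : h * x * h⁻¹ ∈ A := hAn.conj_mem x hxA h
    have h2 : n * h * x * (n * h)⁻¹ = h * x * h⁻¹ := by
      calc n * h * x * (n * h)⁻¹ = n * (h * x * h⁻¹) * n⁻¹ := by group
        _ = h * x * h⁻¹ := by rw [hAc _ hn _ h1]; group
    rw [h2]
    exact Subgroup.mem_inf.2 ⟨h1, mul_mem (mul_mem hh hxM) (inv_mem hh)⟩
  rintro a b hab hb ⟨x, hx⟩
  have hab' : Commute (x⁻¹ * a * x) (x⁻¹ * b * x) := by
    have : x⁻¹ * a * x * (x⁻¹ * b * x) = x⁻¹ * b * x * (x⁻¹ * a * x) := by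
      calc x⁻¹ * a * x * (x⁻¹ * b * x) = x⁻¹ * (a * b) * x := by group
        _ = x⁻¹ * b * x * (x⁻¹ * a * x) := by rw [hab.eq]; group
    exact this
  have hb' : (orderOf (π (x⁻¹ * b * x))).Coprime p := by
    refine Nat.Coprime.coprime_dvd_left ?_ hb
    rw [orderOf_dvd_iff_pow_eq_one, ← map_pow]
    have : (x⁻¹ * b * x) ^ orderOf b = 1 := by
      have := conj_pow (i := orderOf b) (a := x⁻¹) (b := b)
      rw [inv_inv, pow_orderOf_eq_one] at this
      rw [this]; group
    rw [this, map_one]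
  obtain ⟨y, hy⟩ := exists_conj_mul_mem_of_complement hAc hAp hsup hinf ((hmem _).2 hx)
    (hab'.map π) hb'
  obtain ⟨y, rfl⟩ := hπ y
  refine ⟨x * y, ?_⟩
  rw [← map_mul, ← map_inv, ← map_mul, ← map_mul, hmem] at hy
  have : (x * y)⁻¹ * (a * b) * (x * y) = y⁻¹ * (x⁻¹ * a * x * (x⁻¹ * b * x)) * y := by group
  rwa [this]

end Solvable

/-! ### Factorisation into coprime parts -/

section CoprimeFactors

variable {G : Type*} [Group G]

/-- A product of commuting elements of pairwise coprime orders is a factor (or `1`) times a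
commuting element of order prime to `p`. -/
theorem List.exists_prod_eq_mul_coprime {p : ℕ} (hp : p.Prime) (l : List G)
    (hcomm : ∀ x ∈ l, ∀ y ∈ l, Commute x y)
    (hl : l.Pairwise fun x y => (orderOf x).Coprime (orderOf y)) :
    ∃ a b : G, (a = 1 ∨ a ∈ l) ∧ l.prod = a * b ∧ (∀ z, (∀ x ∈ l, Commute z x) → Commute z b) ∧
      (orderOf b).Coprime p := by
  have prod_coprime : ∀ t : List G, (∀ x ∈ t, ∀ y ∈ t, Commute x y) →
      (∀ x ∈ t, (orderOf x).Coprime p) → (orderOf t.prod).Coprime p := fun t => by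
    induction t with
    | nil => simp
    | cons x t ih =>
      intro hc ho
      have hxt : Commute x t.prod :=
        Commute.list_prod_right _ _ fun y hy => hc x (by simp) y (by simp [hy])
      have := ih (fun a ha b hb => hc a (by simp [ha]) b (by simp [hb]))
        fun a ha => ho a (by simp [ha])
      rw [List.prod_cons]
      exact Nat.Coprime.coprime_dvd_left hxt.orderOf_mul_dvd_mul_orderOf
        (Nat.Coprime.mul_left (ho x (by simp)) this)
  induction l with
  | nil => exact ⟨1, 1, by simp⟩
  | cons x t ih =>
    rw [List.pairwise_cons] at hl
    have hct : ∀ x ∈ t, ∀ y ∈ t, Commute x y := fun a ha b hb =>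
      hcomm a (by simp [ha]) b (by simp [hb])
    by_cases hx : (orderOf x).Coprime p
    · obtain ⟨a, b, ha, hab, hz, hb⟩ := ih hct hl.2
      have hxb : Commute x b := hz x fun y hy => hcomm x (by simp) y (by simp [hy])
      have hxa : Commute x a := by
        rcases ha with rfl | ha
        · exact Commute.one_right x
        · exact hcomm x (by simp) a (by simp [ha])
      refine ⟨a, x * b, ha.imp_right (by simp +contextual), ?_, fun z hz' => ?_, ?_⟩
      · rw [List.prod_cons, hab, ← mul_assoc, hxa.eq, mul_assoc]
      · exact (hz' x (by simp)).mul_right (hz z fun y hy => hz' y (by simp [hy]))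
      · exact Nat.Coprime.coprime_dvd_left hxb.orderOf_mul_dvd_mul_orderOf
          (Nat.Coprime.mul_left hx hb)
    -- Since `p` divides the order of `x`, coprimality makes all later factors `p'`-elements.
    · have hpx : p ∣ orderOf x := by
        by_contra h
        exact hx ((Nat.Prime.coprime_iff_not_dvd hp).2 h).symm
      refine ⟨x, t.prod, Or.inr (by simp), List.prod_cons, fun z hz => ?_, ?_⟩
      · exact Commute.list_prod_right _ _ fun y hy => hz y (by simp [hy])
      · exact prod_coprime t hct fun y hy =>
          (Nat.Coprime.coprime_dvd_left hpx (hl.1 y hy)).symm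

/-- An element of finite order is a product of powers of itself of prime-power, pairwise coprime
orders. -/
theorem exists_list_prod_eq_of_orderOf_ne_zero (g : G) (hg : orderOf g ≠ 0) :
    ∃ l : List G, g = l.prod ∧ (∀ x ∈ l, ∃ n : ℕ, x = g ^ n) ∧
      (∀ x ∈ l, HasPrimePowerOrder x) ∧
      l.Pairwise fun x y => (orderOf x).Coprime (orderOf y) := by
  obtain ⟨n, hn⟩ : ∃ n, n = orderOf g := ⟨_, rfl⟩
  induction n using Nat.recOnPosPrimePosCoprime generalizing g with
  | zero => exact absurd hn.symm hg
  | one => exact ⟨[], by simpa using orderOf_eq_one_iff.1 hn.symm, by simp, by simp, by simp⟩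
  | prime_pow p k hp hk =>
    exact ⟨[g], by simp, fun x hx => ⟨1, by simpa using hx⟩,
      fun x hx => ⟨p, k, hp, by rw [List.mem_singleton.1 hx, hn]⟩, by simp⟩
  | coprime r s hr hs hrs ihr ihs =>
    -- `u` and `v` are complementary idempotents modulo `r * s`, so `g ^ u` and `g ^ v` are the two
    -- coprime parts of `g`.
    obtain ⟨u, hu1, hu0⟩ := Nat.chineseRemainder hrs 1 0
    obtain ⟨v, hv0, hv1⟩ := Nat.chineseRemainder hrs 0 1
    have hpow : ∀ {t u e : ℕ}, orderOf g = t * e → t.Coprime e → u ≡ 1 [MOD t] →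
        u ≡ 0 [MOD e] → t ≠ 0 → e ≠ 0 → orderOf (g ^ u) = t := by
      intro t u e ho hte h1 h0 ht he
      have hgcd : (t * e).gcd u = e := by
        have h2 : t.Coprime u := by
          have := h1.gcd_eq
          rw [Nat.gcd_one_left] at this
          rw [Nat.Coprime, Nat.gcd_comm]; exact this
        rw [Nat.Coprime.gcd_mul_left_cancel _ h2]
        exact Nat.gcd_eq_left ((Nat.modEq_zero_iff_dvd).1 h0)
      rcases eq_or_ne u 0 with rfl | hu
      · rw [pow_zero, orderOf_one]
        exact (Nat.dvd_one.1 ((Nat.modEq_iff_dvd' zero_le_one).1 h1)).symm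
      · rw [orderOf_pow' g hu, ho, hgcd, Nat.mul_div_cancel _ (Nat.pos_of_ne_zero he)]
    have hgu : orderOf (g ^ u) = r := hpow hn.symm hrs hu1 hu0 (by omega) (by omega)
    have hgv : orderOf (g ^ v) = s :=
      hpow (by rw [← hn, mul_comm]) hrs.symm hv1 hv0 (by omega) (by omega)
    have hprod : g = g ^ u * g ^ v := by
      rw [← pow_add]
      conv_lhs => rw [← pow_one g]
      rw [pow_eq_pow_iff_modEq, ← hn]
      exact (Nat.modEq_and_modEq_iff_modEq_mul hrs).1
        ⟨by simpa using (hu1.add hv0).symm, by simpa using (hu0.add hv1).symm⟩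
    obtain ⟨l₁, hl₁, hpow₁, hpp₁, hco₁⟩ := ihr (g ^ u) (by omega) hgu.symm
    obtain ⟨l₂, hl₂, hpow₂, hpp₂, hco₂⟩ := ihs (g ^ v) (by omega) hgv.symm
    refine ⟨l₁ ++ l₂, by rw [List.prod_append, ← hl₁, ← hl₂, ← hprod], ?_, ?_, ?_⟩
    · intro x hx
      rcases List.mem_append.1 hx with hx | hx
      · obtain ⟨m, rfl⟩ := hpow₁ x hx
        exact ⟨u * m, (pow_mul _ _ _).symm⟩
      · obtain ⟨m, rfl⟩ := hpow₂ x hx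
        exact ⟨v * m, (pow_mul _ _ _).symm⟩
    · intro x hx
      rcases List.mem_append.1 hx with hx | hx
      exacts [hpp₁ x hx, hpp₂ x hx]
    · refine List.pairwise_append.2 ⟨hco₁, hco₂, fun x hx y hy => ?_⟩
      obtain ⟨m, rfl⟩ := hpow₁ x hx
      obtain ⟨m', rfl⟩ := hpow₂ y hy
      refine Nat.Coprime.coprime_dvd_left (orderOf_pow_dvd m)
        (Nat.Coprime.coprime_dvd_right (orderOf_pow_dvd m') ?_)
      rwa [hgu, hgv]

end CoprimeFactors

/-- In a finite solvable group, replacing each member of an invariably generating family by factors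
of it which are powers of it of pairwise coprime orders preserves invariable generation. -/
theorem InvariablyGenerates.coprime_factors {G : Type*} [Group G] [Finite G] [Group.IsSolvable G]
    {S X : Set G} (hS : InvariablyGenerates S)
    (hX : ∀ g ∈ S, ∃ l : List G, g = l.prod ∧ (∀ x ∈ l, x ∈ X) ∧ (∀ x ∈ l, ∃ n : ℕ, x = g ^ n) ∧
      l.Pairwise fun x y => (orderOf x).Coprime (orderOf y)) : InvariablyGenerates X := by
  classical
  intro c
  by_contra hne
  obtain ⟨M, hM, hle⟩ := (eq_top_or_exists_le_coatom _).resolve_left hne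
  obtain ⟨p, hp, hconj⟩ := exists_prime_forall_conj_mul_mem_of_isCoatom hM
  have key : ∀ g ∈ S, ∃ y : G, y⁻¹ * g * y ∈ M := by
    intro g hg
    obtain ⟨l, hl, hlX, hpow, hco⟩ := hX g hg
    have hcomm : ∀ x ∈ l, ∀ y ∈ l, Commute x y := fun x hx y hy => by
      obtain ⟨m, rfl⟩ := hpow x hx
      obtain ⟨m', rfl⟩ := hpow y hy
      exact Commute.pow_pow_self g m m'
    obtain ⟨a, b, ha, hab, hz, hb⟩ := l.exists_prod_eq_mul_coprime hp hcomm hco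
    rw [hl, hab]
    refine hconj a b (hz a fun x hx => ?_) hb ?_
    · rcases ha with rfl | ha
      · exact Commute.one_left x
      · exact hcomm a ha x hx
    · rcases ha with rfl | ha
      · exact ⟨1, by simp⟩
      · exact ⟨c a, hle (Subgroup.subset_closure ⟨a, hlX a ha, rfl⟩)⟩
  -- These `y` serve as the conjugating elements for `S`, forcing `M = ⊤`.
  choose! y hy using key
  refine hM.1 (top_le_iff.1 ?_)
  rw [← hS y, Subgroup.closure_le]
  rintro _ ⟨g, hg, rfl⟩
  exact hy g hg

theorem theorem1p1 {G : Type*} [Group G] [Finite G] [Group.IsSolvable G] :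
    (∀ (d : ℕ) (g : Fin d → G),
      InvariablyGenerates (Set.range g) →
      (∀ i i' : Fin d, i ≠ i' → (orderOf (g i)).Coprime (orderOf (g i'))) →
      ∀ (u : Fin d → ℕ) (x : (i : Fin d) → Fin (u i) → G),
        (∀ i, g i = (List.ofFn (x i)).prod) →
        (∀ i j, ∃ n : ℕ, x i j = g i ^ n) →
        (∀ i j, HasPrimePowerOrder (x i j)) →
        (∀ i, ∀ j j' : Fin (u i), j ≠ j' →
          (orderOf (x i j)).Coprime (orderOf (x i j'))) →
        InvariablyGenerates {y : G | ∃ (i : Fin d) (j : Fin (u i)), y = x i j}) ∧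
    (IsCIG G ↔ IsPCIG G) := by
  refine ⟨?_, ?_, ?_⟩
  · intro d g hg _ u x hprod hpow _ hco
    refine hg.coprime_factors ?_
    rintro _ ⟨i, rfl⟩
    refine ⟨List.ofFn (x i), hprod i, ?_, ?_, ?_⟩
    · intro y hy
      obtain ⟨j, rfl⟩ := (List.mem_ofFn' _ _).1 hy
      exact ⟨i, j, rfl⟩
    · intro y hy
      obtain ⟨j, rfl⟩ := (List.mem_ofFn' _ _).1 hy
      exact hpow i j
    · exact List.pairwise_ofFn.2 fun j j' hjj' => hco i j j' hjj'.ne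
  · rintro ⟨S, -, hS, hSco⟩
    choose l hprod hpow hpp hco using fun g : G =>
      exists_list_prod_eq_of_orderOf_ne_zero g (orderOf_pos g).ne'
    refine ⟨{y | ∃ g ∈ S, y ∈ l g}, Set.toFinite _, ⟨?_, ?_⟩, ?_⟩
    · exact hS.coprime_factors fun g hg =>
        ⟨l g, hprod g, fun y hy => ⟨g, hg, hy⟩, hpow g, hco g⟩
    · rintro a ⟨g, hg, ha⟩ b ⟨g', hg', hb⟩ hab
      -- Factors of different elements of `S` have orders dividing coprime numbers.
      by_cases h : g = g'
      · subst h
        have : Std.Symm fun x y : G => (orderOf x).Coprime (orderOf y) := ⟨fun _ _ h => h.symm⟩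
        exact (hco g).forall ha hb hab
      · obtain ⟨m, rfl⟩ := hpow g a ha
        obtain ⟨m', rfl⟩ := hpow g' b hb
        exact Nat.Coprime.coprime_dvd_left (orderOf_pow_dvd m)
          (Nat.Coprime.coprime_dvd_right (orderOf_pow_dvd m') (hSco hg hg' h))
    · rintro y ⟨g, _, hy⟩
      exact hpp g y hy
  · rintro ⟨S, hfin, hS, _⟩
    exact ⟨S, hfin, hS⟩
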